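/- Let $n,p\ge 1$ and $m,k\ge 0$ be integers. Let $H=[h_1\dots h_m]^T$ with $h_1,\dots,h_m$ distinct integers in $\{2,\dots,n\}$, and let $\Lambda=[\lambda_1\dots\lambda_m]^T$, $Q=[q_1\dots q_k]^T$, $R=[r_1\dots r_k]^T$ be vectors of non-negative integers. Let $\Lambda K^H_{n\times p}$ be the hypergraph (with repeated edges allowed) whose vertex set is partitioned into $n$ parts of $p$ vertices each, such that for every $j\in\{1,\dots,m\}$ and every set $U$ of $h_j$ vertices with at most one vertex in each part there are exactly $\lambda_j$ edges with vertex set $U$, and there are no other edges. It is called $(Q,R)$-factorizable if its edges can be partitioned into $k$ (possibly empty) classes $F_1,\dots,F_k$ such that every vertex $v$ lies in at least $q_i$ and at most $r_i$ edges of $F_i$, for $1\le i\le k$. Then $\Lambda K^H_{n\times p}$ is $(Q,R)$-factorizable if and only if both of the following hold: 1. $\displaystyle \sum_{i=1}^k q_i\;\le\;\sum_{j=1}^m \lambda_j\binom{n-1}{h_j-1}p^{h_j-1}\;\le\;\sum_{i=1}^k r_i$; 2. there is a non-negative integer matrix $A=[a_{ij}]_{k\times m}$ such that $np\,q_i\le\sum_{j=1}^m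 a_{ij}h_j\le np\,r_i$ for $1\le i\le k$, and $\sum_{i=1}^k a_{ij}=\lambda_j\binom{n}{h_j}p^{h_j}$ for $1\le j\le m$. -/

import Mathlib

/-- A hypergraph with vertices `V`, edges `E` and hinges `W`: every hinge attaches one edge to one
vertex, and every edge has at least one hinge. Several edges may join the same vertices, and
several hinges may attach the same edge to the same vertex. (The hypergraphs of Mathlib have a set
of edges that are sets of vertices, hence no multiplicities.) -/
structure HingeHypergraph (V E W : Type*) where
  /-- the vertex a hinge is incident with -/
  vert : W → V
  /-- the edge a hinge is incident with -/
  edge : W → E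
  edge_surjective : Function.Surjective edge

namespace HingeHypergraph

variable {V E W : Type*}

/-- The degree of a vertex is the number of hinges incident with it. -/
noncomputable def degree (G : HingeHypergraph V E W) (v : V) : ℕ :=
  {x : W | G.vert x = v}.ncard

open Classical in
/-- The edges joining exactly the vertices of the multiset `U`: those attached to every vertex `v`
by as many hinges as the multiplicity of `v` in `U`. -/
def edgesJoining (G : HingeHypergraph V E W) (U : Multiset V) : Set E :=
  {e | ∀ v, {x : W | G.vert x = v ∧ G.edge x = e}.ncard = U.count v}

/-- The multiplicity of the multiset `U` of vertices. -/
noncomputable def mult (G : HingeHypergraph V E W) (U : Multiset V) : ℕ :=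
  (G.edgesJoining U).ncard

/-- The spanning sub-hypergraph with edge set `F`: all vertices of `G`, the edges in `F`, and all
hinges of these edges. -/
def spanningSub (G : HingeHypergraph V E W) (F : Set E) :
    HingeHypergraph V F {x : W // G.edge x ∈ F} where
  vert x := G.vert x
  edge x := ⟨G.edge x, x.2⟩
  edge_surjective := by
    rintro ⟨e, he⟩
    obtain ⟨x, rfl⟩ := G.edge_surjective e
    exact ⟨⟨x, he⟩, rfl⟩

/-- The edge set `F` forms a `(q, r)`-factor of `G`. -/
def IsFactor (G : HingeHypergraph V E W) (q r : ℕ) (F : Set E) : Prop :=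
  ∀ v, q ≤ (G.spanningSub F).degree v ∧ (G.spanningSub F).degree v ≤ r

/-- The edges of `G` can be partitioned into classes `F 1, …, F k` (a class may be empty) such that
`F i` is a `(Q i, R i)`-factor for every `i`. -/
def IsFactorizable (G : HingeHypergraph V E W) {k : ℕ} (Q R : Fin k → ℕ) : Prop :=
  ∃ F : Fin k → Set E, Pairwise (fun i j => Disjoint (F i) (F j)) ∧ (⋃ i, F i) = Set.univ ∧
    ∀ i, G.IsFactor (Q i) (R i) (F i)

/-- `G` is the hypergraph `Λ K^H_{n × p}` with vertex parts `part ⁻¹' {1}, …, part ⁻¹' {n}`: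
each of the `n` parts has `p` vertices, every set of `H j` vertices with at most one vertex from
each part is joined by exactly `Λ j` edges, and there are no other edges. -/
structure IsCompleteMultipartite (G : HingeHypergraph V E W) {n m : ℕ} (part : V → Fin n) (p : ℕ)
    (H Λ : Fin m → ℕ) : Prop where
  ncard_part : ∀ a, {v | part v = a}.ncard = p
  mult_eq : ∀ (j : Fin m) (U : Finset V), U.card = H j → Set.InjOn part U → G.mult U.val = Λ j
  exists_mem : ∀ e, ∃ (j : Fin m) (U : Finset V),
    U.card = H j ∧ Set.InjOn part U ∧ e ∈ G.edgesJoining U.val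

end HingeHypergraph

/-! A factorization is an edge colouring. If a_ij counts the edges of size h_j in colour i, summing
degrees over all np vertices gives the matrix condition; summing that over the colours and dividing
by np gives the degree condition.

Conversely, given A, take a_ij abstract edges of colour i and size h_j and attach them to partial
transversals so that each transversal of size h_j is used λ_j times and all degrees respect the
bounds. This is Baranyai's method, points being treated one at a time. If an edge still has to pick
w of N + 1 points, giving it the current point with weight w/(N + 1) meets all requirements
fractionally. These are integral interval constraints on coordinates and on sums over the classes of
two partitions, by the data of the edge so far and by colour, so an integral solution exists
(`exists_integral_point`, `exists_fair_selection`). Iteration gives `exists_fair_distribution`,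
which chooses first the parts an edge meets and then its vertex in each part
(`exists_fair_assignment`, `exists_fair_transversals`). Every transversal is then used as often as
in the given hypergraph, so a bijection of edges transports the colouring. -/

/-! ### Integrality of transportation polytopes -/

/-- At an extreme point of a polyhedron, the active constraints determine the point. -/
theorem eq_zero_of_mem_extremePoints {X ι : Type*} [Finite ι]
    (c : ι → (X → ℝ) → ℝ) (hadd : ∀ i x y, c i (x + y) = c i x + c i y)
    (hsmul : ∀ i (t : ℝ) x, c i (t • x) = t * c i x)
    (l u : ι → ℝ) (x : X → ℝ)
    (hx : x ∈ Set.extremePoints ℝ {x | ∀ i, l i ≤ c i x ∧ c i x ≤ u i}) (z : X → ℝ)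
    (hz : ∀ i, c i x = l i ∨ c i x = u i → c i z = 0) : z = 0 := by
  -- Active constraints are constant along `z` and the others have slack, so `x` is the midpoint of
  -- a feasible segment in direction `z`.
  have hev : ∀ i, ∀ᶠ t : ℝ in nhds 0, l i ≤ c i x + t * c i z ∧ c i x + t * c i z ≤ u i := by
    intro i
    have hb := hx.1 i
    by_cases h : c i x = l i ∨ c i x = u i
    · simp [hz i h, hb]
    · push Not at h
      have hcont : Filter.Tendsto (fun t : ℝ => c i x + t * c i z) (nhds 0) (nhds (c i x)) := by
        have : Continuous (fun t : ℝ => c i x + t * c i z) := by fun_prop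
        simpa using this.tendsto 0
      filter_upwards [(tendsto_order.1 hcont).1 _ (lt_of_le_of_ne hb.1 h.1.symm),
        (tendsto_order.1 hcont).2 _ (lt_of_le_of_ne hb.2 h.2)] with t h1 h2
      exact ⟨h1.le, h2.le⟩
  obtain ⟨ε, hε, hball⟩ := Metric.eventually_nhds_iff.1 (Filter.eventually_all.2 hev)
  have hmem : ∀ t : ℝ, |t| < ε → x + t • z ∈ {x | ∀ i, l i ≤ c i x ∧ c i x ≤ u i} := by
    intro t ht i
    rw [hadd, hsmul]
    exact hball (by simpa using ht) i
  have h1 := hmem (ε / 2) (by rw [abs_of_pos (by positivity)]; linarith)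
  have h2 := hmem (-(ε / 2)) (by rw [abs_neg, abs_of_pos (by positivity)]; linarith)
  have key := hx.2 h1 h2 ⟨1 / 2, 1 / 2, by norm_num, by norm_num, by norm_num, by
    ext i; simp; ring⟩
  have : (ε / 2) • z = 0 := by simpa using key
  exact (smul_eq_zero.1 this).resolve_left (by positivity)

/-- If every class of `f` meeting the set of non-integral coordinates has an integral sum, then it
contains at least two non-integral coordinates. -/
theorem two_mul_card_le_card_filter_nonintegral {X A : Type*} [Fintype X] [DecidableEq A]
    (f : X → A) (x : X → ℝ) (F : Finset X)
    (hF : ∀ y, y ∈ F ↔ x y ∉ (Int.castAddHom ℝ).range) (T : Finset A)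
    (hT : ∀ a ∈ T, (∑ y with f y = a, x y) ∈ (Int.castAddHom ℝ).range ∧ ∃ y ∈ F, f y = a) :
    2 * T.card ≤ (F.filter (fun y => f y ∈ T)).card := by
  classical
  have hfib := Finset.card_eq_sum_card_fiberwise (f := f) (s := F.filter (fun y => f y ∈ T))
    (t := T) (fun y hy => (Finset.mem_filter.1 hy).2)
  rw [hfib, mul_comm, ← smul_eq_mul]
  refine Finset.card_nsmul_le_sum _ _ _ fun a ha => ?_
  obtain ⟨hint, y, hy, hya⟩ := hT a ha
  by_contra! hlt
  have hone : ∀ y' ∈ F, f y' = a → y' = y := by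
    intro y' hy' hya'
    refine Finset.card_le_one.1 (Nat.le_of_lt_succ hlt) _ ?_ _ ?_ <;> simp_all
  have hmem : y ∈ (Finset.univ.filter (fun y => f y = a)) := by simp [hya]
  -- A lone non-integral term would be a difference of integers.
  rw [← Finset.add_sum_erase _ _ hmem] at hint
  have hrest : ∑ y' ∈ (Finset.univ.filter (fun y => f y = a)).erase y, x y' ∈
      (Int.castAddHom ℝ).range := by
    refine AddSubgroup.sum_mem _ fun y' hy' => ?_
    simp only [Finset.mem_erase, Finset.mem_filter, Finset.mem_univ, true_and] at hy'
    by_contra hn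
    exact hy'.1 (hone y' ((hF y').2 hn) hy'.2)
  exact (hF y).1 hy ((AddSubgroup.add_mem_cancel_right _ hrest).1 hint)

/-- A point with a non-integral coordinate can be perturbed in its non-integral coordinates so
that all integral sums over classes of `f` and of `g` are preserved. -/
theorem exists_perturbation {X A B : Type*} [Fintype X] [Fintype A] [Fintype B]
    [DecidableEq A] [DecidableEq B] (f : X → A) (g : X → B) (x : X → ℝ)
    (hx : ∃ y, x y ∉ (Int.castAddHom ℝ).range) :
    ∃ z : X → ℝ, z ≠ 0 ∧ (∀ y, x y ∈ (Int.castAddHom ℝ).range → z y = 0) ∧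
      (∀ a, (∑ y with f y = a, x y) ∈ (Int.castAddHom ℝ).range → ∑ y with f y = a, z y = 0) ∧
      (∀ b, (∑ y with g y = b, x y) ∈ (Int.castAddHom ℝ).range → ∑ y with g y = b, z y = 0) := by
  classical
  set F : Finset X := Finset.univ.filter (fun y => x y ∉ (Int.castAddHom ℝ).range) with hFdef
  have hF : ∀ y, y ∈ F ↔ x y ∉ (Int.castAddHom ℝ).range := by simp [hFdef]
  set TA : Finset A := Finset.univ.filter (fun a =>
    (∑ y with f y = a, x y) ∈ (Int.castAddHom ℝ).range ∧ ∃ y ∈ F, f y = a) with hTA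
  set TB : Finset B := Finset.univ.filter (fun b =>
    (∑ y with g y = b, x y) ∈ (Int.castAddHom ℝ).range ∧ ∃ y ∈ F, g y = b) with hTB
  have cA := two_mul_card_le_card_filter_nonintegral f x F hF TA
    (fun a ha => (Finset.mem_filter.1 ha).2)
  have cB := two_mul_card_le_card_filter_nonintegral g x F hF TB
    (fun a ha => (Finset.mem_filter.1 ha).2)
  have cA' := Finset.card_filter_le F (fun y => f y ∈ TA)
  have cB' := Finset.card_filter_le F (fun y => g y ∈ TB)
  let L : (F → ℝ) →ₗ[ℝ] (TA → ℝ) × (TB → ℝ) :=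
    { toFun := fun z => (fun a => ∑ y with f y.1 = a.1, z y, fun b => ∑ y with g y.1 = b.1, z y)
      map_add' := fun z w => by ext <;> simp [Finset.sum_add_distrib]
      map_smul' := fun t z => by ext <;> simp [Finset.mul_sum] }
  -- The target has dimension at most `F.card`. Injectivity would force equality, hence
  -- surjectivity, and every class meeting `F` would be in `TA` or `TB`. But the two families of
  -- class sums have the same total, so `(1, 0)` is not attained.
  have hker : ¬ Function.Injective L := by
    intro hinj
    have hle := LinearMap.finrank_le_finrank_of_injective hinj
    simp only [Module.finrank_prod, Module.finrank_fintype_fun_eq_card, Fintype.card_coe] at hle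
    have hsurj : Function.Surjective L := by
      refine (LinearMap.injective_iff_surjective_of_finrank_eq_finrank ?_).1 hinj
      simp only [Module.finrank_prod, Module.finrank_fintype_fun_eq_card, Fintype.card_coe]
      omega
    have hfA : ∀ y ∈ F, f y ∈ TA :=
      Finset.card_filter_eq_iff.1 (by omega)
    have hfB : ∀ y ∈ F, g y ∈ TB :=
      Finset.card_filter_eq_iff.1 (by omega)
    obtain ⟨z, hz⟩ := hsurj (fun _ => 1, fun _ => 0)
    have h1 : ∑ y, z y = ∑ a : TA, (1 : ℝ) := by
      rw [← Finset.sum_fiberwise Finset.univ (fun y : F => (⟨f y.1, hfA _ y.2⟩ : TA)) z]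
      refine Finset.sum_congr rfl fun a _ => ?_
      have := congrFun (congrArg Prod.fst hz) a
      simpa [L, Subtype.ext_iff] using this
    have h2 : ∑ y, z y = ∑ b : TB, (0 : ℝ) := by
      rw [← Finset.sum_fiberwise Finset.univ (fun y : F => (⟨g y.1, hfB _ y.2⟩ : TB)) z]
      refine Finset.sum_congr rfl fun a _ => ?_
      have := congrFun (congrArg Prod.snd hz) a
      simpa [L, Subtype.ext_iff] using this
    have h3 : (TA.card : ℝ) = 0 := by
      have := h1.symm.trans h2
      simpa using this
    obtain ⟨y, hy⟩ := hx
    have : TA = ∅ := Finset.card_eq_zero.1 (by exact_mod_cast h3)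
    simpa [this] using hfA y ((hF y).2 hy)
  obtain ⟨z, hz, hz0⟩ : ∃ z, L z = 0 ∧ z ≠ 0 := by
    by_contra! hcon
    exact hker ((injective_iff_map_eq_zero L).2 hcon)
  have hsum : ∀ (s : X → Prop) [DecidablePred s],
      ∑ y with s y, (if h : y ∈ F then z ⟨y, h⟩ else 0) = ∑ y : F with s y.1, z y := by
    intro s _
    rw [Finset.sum_filter, Finset.sum_filter, ← Finset.sum_subset (Finset.subset_univ F),
      ← Finset.sum_attach, Finset.univ_eq_attach]
    · exact Finset.sum_congr rfl fun y _ => by simp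
    · intro y _ hy
      simp [hy]
  refine ⟨fun y => if h : y ∈ F then z ⟨y, h⟩ else 0, ?_, ?_, ?_, ?_⟩
  · intro h
    refine hz0 (funext fun y => ?_)
    simpa using congrFun h y.1
  · intro y hy
    have : y ∉ F := fun h => (hF y).1 h hy
    simp [this]
  · intro a ha
    rw [hsum (fun y => f y = a)]
    by_cases hat : ∃ y ∈ F, f y = a
    · exact congrFun (congrArg Prod.fst hz) ⟨a, Finset.mem_filter.2 ⟨Finset.mem_univ _, ha, hat⟩⟩
    · push Not at hat
      rw [Finset.filter_false_of_mem (fun y _ => hat y.1 y.2), Finset.sum_empty]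
  · intro b hb
    rw [hsum (fun y => g y = b)]
    by_cases hat : ∃ y ∈ F, g y = b
    · exact congrFun (congrArg Prod.snd hz) ⟨b, Finset.mem_filter.2 ⟨Finset.mem_univ _, hb, hat⟩⟩
    · push Not at hat
      rw [Finset.filter_false_of_mem (fun y _ => hat y.1 y.2), Finset.sum_empty]

/-- Integrality of the transportation polytope with integral bounds on the coordinates and on the
sums over the classes of `f` and of `g`. -/
theorem exists_integral_point {X A B : Type*} [Fintype X] [Fintype A] [Fintype B]
    [DecidableEq A] [DecidableEq B] (f : X → A) (g : X → B) (l u : X → ℤ) (lA uA : A → ℤ)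
    (lB uB : B → ℤ) (x : X → ℝ) (hx : ∀ y, (l y : ℝ) ≤ x y ∧ x y ≤ u y)
    (hA : ∀ a, (lA a : ℝ) ≤ ∑ y with f y = a, x y ∧ ∑ y with f y = a, x y ≤ uA a)
    (hB : ∀ b, (lB b : ℝ) ≤ ∑ y with g y = b, x y ∧ ∑ y with g y = b, x y ≤ uB b) :
    ∃ z : X → ℤ, (∀ y, l y ≤ z y ∧ z y ≤ u y) ∧
      (∀ a, lA a ≤ ∑ y with f y = a, z y ∧ ∑ y with f y = a, z y ≤ uA a) ∧
      (∀ b, lB b ≤ ∑ y with g y = b, z y ∧ ∑ y with g y = b, z y ≤ uB b) := by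
  classical
  let c : X ⊕ A ⊕ B → (X → ℝ) → ℝ := fun i x => match i with
    | .inl y => x y
    | .inr (.inl a) => ∑ y with f y = a, x y
    | .inr (.inr b) => ∑ y with g y = b, x y
  let lo : X ⊕ A ⊕ B → ℤ := Sum.elim l (Sum.elim lA lB)
  let hi : X ⊕ A ⊕ B → ℤ := Sum.elim u (Sum.elim uA uB)
  have hcont : ∀ i, Continuous (c i) := by
    rintro (y | a | b) <;> simp only [c] <;> fun_prop
  let P : Set (X → ℝ) := {x | ∀ i, ((lo i : ℤ) : ℝ) ≤ c i x ∧ c i x ≤ ((hi i : ℤ) : ℝ)}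
  have hxP : x ∈ P := by
    rintro (y | a | b)
    · exact hx y
    · exact hA a
    · exact hB b
  have hcomp : IsCompact P := by
    refine (isCompact_Icc (a := fun y => (l y : ℝ)) (b := fun y => (u y : ℝ))).of_isClosed_subset
      ?_ fun x hx => ⟨fun y => (hx (.inl y)).1, fun y => (hx (.inl y)).2⟩
    simp only [P, Set.ofPred_forall, Set.ofPred_and]
    exact isClosed_iInter fun i => (isClosed_le continuous_const (hcont i)).inter
      (isClosed_le (hcont i) continuous_const)
  obtain ⟨w, hw⟩ := hcomp.extremePoints_nonempty ⟨x, hxP⟩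
  have hint : ∀ y, w y ∈ (Int.castAddHom ℝ).range := by
    by_contra! hcon
    obtain ⟨z, hz0, hz1, hz2, hz3⟩ := exists_perturbation f g w hcon
    refine hz0 (eq_zero_of_mem_extremePoints c ?_ ?_ _ _ w hw z ?_)
    · rintro (y | a | b) <;> intros <;> simp [c, Finset.sum_add_distrib]
    · rintro (y | a | b) <;> intros <;> simp [c, Finset.mul_sum]
    · intro i hi'
      -- An active constraint takes the value of an integral bound, so the perturbation preserves
      -- it.
      have hr : c i w ∈ (Int.castAddHom ℝ).range := by
        rcases hi' with h | h
        · exact ⟨lo i, h.symm⟩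
        · exact ⟨hi i, h.symm⟩
      rcases i with y | a | b
      · exact hz1 y hr
      · exact hz2 a hr
      · exact hz3 b hr
  choose z hz using hint
  have hz' : w = fun y => (z y : ℝ) := funext fun y => (hz y).symm
  subst hz'
  refine ⟨z, fun y => ?_, fun a => ?_, fun b => ?_⟩
  · have := hw.1 (.inl y)
    simpa [c, lo, hi] using this
  · have := hw.1 (.inr (.inl a))
    simp only [c, lo, hi, Sum.elim_inr, Sum.elim_inl] at this
    exact_mod_cast this
  · have := hw.1 (.inr (.inr b))
    simp only [c, lo, hi, Sum.elim_inr] at this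
    exact_mod_cast this

/-! ### Baranyai-type distributions -/

section

open Finset

/-- Given a weight between `0` and `N + 1` that is constant on the classes of `f`, one can select
each element with "probability" `w / (N + 1)` so that the class sizes are as expected and the bounds
on the average weight in the classes of `g` are respected by the selected and by the
remaining weight. -/
theorem exists_fair_selection {X A B : Type*} [Fintype X] [Fintype A] [Fintype B]
    [DecidableEq A] [DecidableEq B] (f : X → A) (g : X → B) (N : ℕ) (w M : A → ℕ)
    (lo hi : B → ℕ) (hA : ∀ a, #{y | f y = a} = M a * (N + 1).choose (w a))
    (hB : ∀ b, (N + 1) * lo b ≤ ∑ y with g y = b, w (f y) ∧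
      ∑ y with g y = b, w (f y) ≤ (N + 1) * hi b) :
    ∃ Y : Finset X,
      (∀ a, #{y ∈ Y | f y = a} = if w a = 0 then 0 else M a * N.choose (w a - 1)) ∧
      ∀ b, (lo b ≤ #{y ∈ Y | g y = b} ∧ #{y ∈ Y | g y = b} ≤ hi b) ∧
        N * lo b + #{y ∈ Y | g y = b} ≤ ∑ y with g y = b, w (f y) ∧
        ∑ y with g y = b, w (f y) ≤ N * hi b + #{y ∈ Y | g y = b} := by
  classical
  have hN : (0 : ℝ) < N + 1 := by positivity
  have key := exists_integral_point f g (fun _ => 0) (fun _ => 1)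
    (fun a => ((if w a = 0 then 0 else M a * N.choose (w a - 1) : ℕ) : ℤ))
    (fun a => ((if w a = 0 then 0 else M a * N.choose (w a - 1) : ℕ) : ℤ))
    -- The selected number must lie in `[lo, hi]` and the remaining weight in `[N * lo, N * hi]`;
    -- together these are one interval for the class sum.
    (fun b => max (lo b) ((∑ y with g y = b, w (f y) : ℕ) - N * hi b))
    (fun b => min (hi b) ((∑ y with g y = b, w (f y) : ℕ) - N * lo b))
    (fun y => (w (f y) : ℝ) / (N + 1)) ?_ ?_ ?_
  · obtain ⟨z, hz, hzA, hzB⟩ := key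
    have hz01 : ∀ y, z y = if z y = 1 then 1 else 0 := by
      intro y
      have := hz y
      split_ifs <;> omega
    have hsum : ∀ (s : X → Prop) [DecidablePred s],
        ∑ y with s y, z y = (#{y ∈ Finset.univ.filter (fun y => z y = 1) | s y} : ℤ) := by
      intro s _
      rw [Finset.sum_congr rfl fun y _ => hz01 y, Finset.sum_boole, Finset.filter_filter,
        Finset.filter_filter]
      simp only [and_comm]
    refine ⟨Finset.univ.filter (fun y => z y = 1), fun a => ?_, fun b => ?_⟩
    · have := hzA a
      rw [hsum] at this
      exact_mod_cast le_antisymm this.2 this.1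
    · have := hzB b
      rw [hsum, max_le_iff, le_min_iff] at this
      zify
      push_cast at this
      refine ⟨⟨this.1.1, this.2.1⟩, ?_, ?_⟩
      · linarith [this.2.2]
      · linarith [this.1.2]
  · intro y
    have hw : w (f y) ≤ N + 1 := by
      by_contra! h
      have h0 := hA (f y)
      rw [Nat.choose_eq_zero_of_lt h, mul_zero, Finset.card_eq_zero] at h0
      have : y ∈ (∅ : Finset X) := h0 ▸ (by simp)
      simp at this
    constructor
    · push_cast; positivity
    · rw [div_le_iff₀ hN]
      push_cast
      rw [one_mul]
      exact_mod_cast hw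
  · intro a
    -- Absorption: `w * (N + 1).choose w = (N + 1) * N.choose (w - 1)`. The case `w = 0` is separate
    -- because truncated subtraction would give `N.choose 0 = 1`.
    have h1 : ∑ y with f y = a, (w (f y) : ℝ) / (N + 1) =
        ((if w a = 0 then 0 else M a * N.choose (w a - 1) : ℕ) : ℝ) := by
      rw [Finset.sum_congr rfl (g := fun _ => (w a : ℝ) / (N + 1))
        (fun y hy => by rw [(Finset.mem_filter.1 hy).2]), Finset.sum_const, nsmul_eq_mul, hA]
      split_ifs with h
      · simp [h]
      · obtain ⟨k, hk⟩ := Nat.exists_eq_succ_of_ne_zero h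
        have := Nat.add_one_mul_choose_eq N k
        rw [hk, Nat.succ_sub_one, Nat.succ_eq_add_one, ← mul_div_assoc, div_eq_iff hN.ne']
        have h2 : ((N : ℝ) + 1) * N.choose k = (N + 1).choose (k + 1) * (k + 1) := by
          exact_mod_cast this
        push_cast
        linear_combination (-(M a : ℝ)) * h2
    rw [h1]
    simp
  · intro b
    obtain ⟨h1, h2⟩ := hB b
    rw [← Finset.sum_div]
    have h1' : ((N : ℝ) + 1) * lo b ≤ ∑ y with g y = b, (w (f y) : ℝ) := by exact_mod_cast h1
    have h2' : ∑ y with g y = b, (w (f y) : ℝ) ≤ ((N : ℝ) + 1) * hi b := by exact_mod_cast h2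
    have hN0 : (0 : ℝ) ≤ N := by positivity
    set R := ∑ y with g y = b, (w (f y) : ℝ) with hR
    constructor
    · push_cast
      rw [max_le_iff, ← hR, le_div_iff₀ hN, le_div_iff₀ hN]
      constructor
      · linarith
      · nlinarith [mul_le_mul_of_nonneg_left h2' hN0]
    · push_cast
      rw [le_min_iff, ← hR, div_le_iff₀ hN, div_le_iff₀ hN]
      constructor
      · linarith
      · nlinarith [mul_le_mul_of_nonneg_left h1' hN0]

/-- A version of Baranyai's theorem: if the class of `a` has `M a` elements for each `w a`-subset of
`Fin N`, then all subsets can be distributed evenly within the classes of `f` such that the number of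
occurrences of every element of `Fin N` in a class of `g` respects the bounds on its average. -/
theorem exists_fair_distribution {X A B : Type*} [Fintype X] [Fintype A] [Fintype B]
    [DecidableEq A] [DecidableEq B] (f : X → A) (g : X → B) (N : ℕ) (w M : A → ℕ)
    (lo hi : B → ℕ) (hA : ∀ a, #{y | f y = a} = M a * N.choose (w a))
    (hB : ∀ b, N * lo b ≤ ∑ y with g y = b, w (f y) ∧ ∑ y with g y = b, w (f y) ≤ N * hi b) :
    ∃ T : X → Finset (Fin N), (∀ y, #(T y) = w (f y)) ∧
      (∀ a S, #S = w a → #{y | f y = a ∧ T y = S} = M a) ∧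
      ∀ b s, lo b ≤ #{y | g y = b ∧ s ∈ T y} ∧ #{y | g y = b ∧ s ∈ T y} ≤ hi b := by
  classical
  induction N generalizing A with
  | zero =>
    refine ⟨fun _ => ∅, fun y => ?_, fun a S hS => ?_, fun b s => s.elim0⟩
    · by_contra h
      have h0 := hA (f y)
      rw [Nat.choose_eq_zero_of_lt (by simp at h; omega), mul_zero, Finset.card_eq_zero] at h0
      have : y ∈ (∅ : Finset X) := h0 ▸ (by simp)
      simp at this
    · have hS0 : S = ∅ := Subsingleton.elim _ _
      subst hS0
      have := hA a
      rw [← hS] at this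
      simpa using this
  | succ N ih =>
    obtain ⟨Y, hYA, hYB⟩ := exists_fair_selection f g N w M lo hi hA hB
    have hpos : ∀ y ∈ Y, w (f y) ≠ 0 := by
      intro y hy h0
      have h1 := hYA (f y)
      rw [if_pos h0, Finset.card_eq_zero] at h1
      have : y ∈ (∅ : Finset X) := h1 ▸ (by simp [hy])
      simp at this
    have hsub : ∀ y, (if y ∈ Y then w (f y) - 1 else w (f y)) + (if y ∈ Y then 1 else 0) =
        w (f y) := by
      intro y
      by_cases hy : y ∈ Y
      · have := hpos y hy
        simp only [hy, if_true]
        omega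
      · simp [hy]
    -- `Y` holds the elements whose set will contain `0`. Refining the classes by membership in `Y`
    -- keeps all subsets equally frequent when the other `N` points are distributed.
    have key := ih (fun y => (f y, decide (y ∈ Y)))
      (fun a => if a.2 = true then w a.1 - 1 else w a.1)
      -- Selected elements have positive weight, so this class is empty when `w a.1 = 0`.
      (fun a => if a.2 = true ∧ w a.1 = 0 then 0 else M a.1) ?_ ?_
    · obtain ⟨T, hT, hTA, hTB⟩ := key
      refine ⟨fun y => Finset.univ.filter
        (fun i => Fin.cases (motive := fun _ => Prop) (y ∈ Y) (fun i => i ∈ T y) i), ?_, ?_, ?_⟩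
      · intro y
        have := hT y
        have h2 := hsub y
        simp only [decide_eq_true_eq] at this
        rw [Fin.card_filter_univ_succ]
        by_cases hy : y ∈ Y
        · simp only [hy, if_true] at this h2
          simp [hy]
          omega
        · simp only [hy, if_false] at this h2
          simp [hy]
          omega
      · intro a S hS
        have hS' : #S = if 0 ∈ S then #{i : Fin N | i.succ ∈ S} + 1
            else #{i : Fin N | i.succ ∈ S} := by
          conv_lhs => rw [← Finset.filter_univ_mem S, Fin.card_filter_univ_succ]
        have key := hTA (a, decide (0 ∈ S)) (Finset.univ.filter (fun i : Fin N => i.succ ∈ S)) ?_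
        · have hw : ¬ (0 ∈ S ∧ w a = 0) := by
            rintro ⟨h0, h1⟩
            rw [if_pos h0] at hS'
            omega
          simp only [decide_eq_true_eq, hw, if_false] at key
          rw [← key]
          congr 1
          ext y
          simp only [Finset.mem_filter, Finset.mem_univ, true_and, Prod.mk.injEq, decide_eq_decide,
            Finset.ext_iff, Fin.forall_fin_succ, Fin.cases_zero, Fin.cases_succ]
          tauto
        · simp only [decide_eq_true_eq]
          split_ifs at * <;> omega
      · intro b s
        refine Fin.cases ?_ (fun s => ?_) s
        · have := (hYB b).1
          simp only [Finset.mem_filter, Finset.mem_univ, true_and, Fin.cases_zero]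
          have he : Finset.univ.filter (fun y => g y = b ∧ y ∈ Y) = Y.filter (fun y => g y = b) := by
            ext y; simp [and_comm]
          rwa [he]
        · simpa using hTB b s
    · rintro ⟨a, c⟩
      have hcard := Finset.card_filter_add_card_filter_not (s := Finset.univ.filter (fun y => f y = a))
        (fun y => y ∈ Y)
      have e1 : (Finset.univ.filter (fun y => f y = a)).filter (fun y => y ∈ Y) =
          Y.filter (fun y => f y = a) := by
        ext y; simp [and_comm]
      rw [e1, hYA a, hA a] at hcard
      cases c
      · simp only [Prod.mk.injEq, decide_eq_false_iff_not, Bool.false_eq_true, if_false, false_and]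
        rw [← Finset.filter_filter]
        by_cases h : w a = 0
        · simpa [h] using hcard
        · obtain ⟨k, hk⟩ := Nat.exists_eq_succ_of_ne_zero h
          -- Pascal's rule counts the unselected elements.
          rw [if_neg h, hk, Nat.succ_sub_one, Nat.succ_eq_add_one, Nat.choose_succ_succ,
            mul_add] at hcard
          rw [hk]
          exact Nat.add_left_cancel hcard
      · simp only [Prod.mk.injEq, decide_eq_true_eq, if_true, true_and]
        rw [← Finset.filter_filter, e1, hYA a]
        split_ifs <;> simp
    · intro b
      have h2 := (hYB b).2
      have h3 : ∑ y with g y = b, w (f y) =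
          ∑ y with g y = b, (if y ∈ Y then w (f y) - 1 else w (f y)) + #{y ∈ Y | g y = b} := by
        have e : Y.filter (fun y => g y = b) =
            (Finset.univ.filter (fun y => g y = b)).filter (fun y => y ∈ Y) := by
          ext y; simp [and_comm]
        rw [e, Finset.card_filter, ← Finset.sum_add_distrib]
        exact Finset.sum_congr rfl fun y _ => (hsub y).symm
      simp only [decide_eq_true_eq]
      omega

/-- If `M l * p ^ #(s l)` elements are labelled `l`, then one can assign to each of them a point of
`Fin p` at every `i ∈ s l ∩ D` such that all assignments occur equally often and the number of
occurrences of every point in the classes of `g` respects the bounds on its average. -/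
theorem exists_fair_assignment {X L B ι : Type*} [Fintype X] [Fintype L] [Fintype B] [Fintype ι]
    [DecidableEq L] [DecidableEq B] [DecidableEq ι] (f : X → L) (g : X → B) (s : L → Finset ι)
    (p : ℕ) (M : L → ℕ) (lo hi : B → ℕ) (hM : ∀ l, #{y | f y = l} = M l * p ^ #(s l))
    (hB : ∀ b i, p * lo b ≤ #{y | g y = b ∧ i ∈ s (f y)} ∧
      #{y | g y = b ∧ i ∈ s (f y)} ≤ p * hi b) (D : Finset ι) :
    ∃ φ : X → ι → Finset (Fin p),
      (∀ y i, #(φ y i) = if i ∈ s (f y) ∧ i ∈ D then 1 else 0) ∧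
      (∀ l ψ, (∀ i, #(ψ i) = if i ∈ s l ∧ i ∈ D then 1 else 0) →
        #{y | f y = l ∧ φ y = ψ} = M l * p ^ #(s l \ D)) ∧
      ∀ b, ∀ i ∈ D, ∀ t, lo b ≤ #{y | g y = b ∧ t ∈ φ y i} ∧ #{y | g y = b ∧ t ∈ φ y i} ≤ hi b := by
  classical
  induction D using Finset.induction_on with
  | empty =>
    refine ⟨fun _ _ => ∅, by simp, fun l ψ hψ => ?_, by simp⟩
    have : ψ = fun _ => ∅ := by
      funext i
      simpa using hψ i
    subst this
    simpa using hM l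
  | insert a D ha ih =>
    obtain ⟨φ, hφ, hφM, hφB⟩ := ih
    -- For the new index `a`, distribute subsets of `Fin p` of size one or zero. Refining the labels
    -- by `φ` makes the choice at `a` even within every earlier pattern; patterns of the wrong shape
    -- do not occur and get multiplicity `0`.
    have key := exists_fair_distribution (fun y => (f y, φ y)) g p
      (fun c => if a ∈ s c.1 then 1 else 0)
      (fun c => if ∀ i, #(c.2 i) = if i ∈ s c.1 ∧ i ∈ D then 1 else 0 then
        M c.1 * p ^ #(s c.1 \ insert a D) else 0) lo hi ?_ ?_
    · obtain ⟨T, hT, hTM, hTB⟩ := key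
      have hφa : ∀ y, φ y a = ∅ := fun y => by simpa [ha] using hφ y a
      refine ⟨fun y => Function.update (φ y) a (T y), fun y i => ?_, fun l ψ hψ => ?_,
        fun b i hi t => ?_⟩
      · by_cases hia : i = a
        · subst hia
          simpa using hT y
        · simpa [hia] using hφ y i
      · have hψ' : ∀ i, #(Function.update ψ a ∅ i) = if i ∈ s l ∧ i ∈ D then 1 else 0 := by
          intro i
          by_cases hia : i = a
          · subst hia
            simp [ha]
          · simpa [hia] using hψ i
        have h1 := hTM (l, Function.update ψ a ∅) (ψ a) (by simpa using hψ a)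
        simp only [hψ', implies_true, if_true] at h1
        rw [← h1]
        congr 1
        ext y
        simp only [Finset.mem_filter, Finset.mem_univ, true_and, Prod.mk.injEq]
        constructor
        · rintro ⟨rfl, h⟩
          refine ⟨⟨rfl, ?_⟩, by simp [← h]⟩
          rw [← h, Function.update_idem, ← hφa y, Function.update_eq_self]
        · rintro ⟨⟨rfl, h⟩, h'⟩
          refine ⟨rfl, ?_⟩
          rw [h, h', Function.update_idem, Function.update_eq_self]
      · by_cases hia : i = a
        · subst hia
          simpa using hTB b t
        · simpa [hia] using hφB b i (Finset.mem_of_mem_insert_of_ne hi hia) t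
    · rintro ⟨l, ψ⟩
      simp only [Prod.mk.injEq]
      split_ifs with h1 h2 h2
      · rw [hφM l ψ h1]
        have : s l \ D = insert a (s l \ insert a D) := by
          ext i
          by_cases hia : i = a
          · subst hia; simp [h2, ha]
          · simp [hia]
        rw [this, Finset.card_insert_of_notMem (by simp), Nat.choose_one_right, pow_succ, mul_assoc]
      · rw [hφM l ψ h1]
        have : s l \ D = s l \ insert a D := by
          ext i
          by_cases hia : i = a
          · subst hia; simp [h2]
          · simp [hia]
        rw [this, Nat.choose_zero_right, mul_one]
      all_goals
        rw [zero_mul, Finset.card_eq_zero, Finset.filter_eq_empty_iff]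
        rintro y - ⟨rfl, rfl⟩
        exact h1 (hφ y)
    · intro b
      have := hB b a
      rwa [← Finset.filter_filter, Finset.card_filter] at this

/-- A multipartite version of Baranyai's theorem: if there are as many elements in the class of `a`
as are needed, then all partial transversals with `h a` elements of the rows of `Fin n × Fin p` can
be distributed evenly within the classes of `f` such that the number of occurrences of every point
in a class of `g` respects the bounds on its average. -/
theorem exists_fair_transversals {X A B : Type*} [Fintype X] [Fintype A] [Fintype B]
    [DecidableEq A] [DecidableEq B] (f : X → A) (g : X → B) (n p : ℕ) (h M : A → ℕ)
    (lo hi : B → ℕ) (hA : ∀ a, #{y | f y = a} = M a * n.choose (h a) * p ^ h a)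
    (hB : ∀ b, n * p * lo b ≤ ∑ y with g y = b, h (f y) ∧
      ∑ y with g y = b, h (f y) ≤ n * p * hi b) :
    ∃ U : X → Finset (Fin n × Fin p),
      (∀ y, #(U y) = h (f y) ∧ Set.InjOn Prod.fst (U y : Set (Fin n × Fin p))) ∧
      (∀ a (S : Finset (Fin n × Fin p)), #S = h a →
        Set.InjOn Prod.fst (S : Set (Fin n × Fin p)) → #{y | f y = a ∧ U y = S} = M a) ∧
      ∀ b v, lo b ≤ #{y | g y = b ∧ v ∈ U y} ∧ #{y | g y = b ∧ v ∈ U y} ≤ hi b := by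
  classical
  -- Each set of `h a` rows supports `p ^ h a` transversals, hence its multiplicity; a row has `p`
  -- points, hence the factor `p` in the bounds.
  obtain ⟨T, hT, hTM, hTB⟩ := exists_fair_distribution f g n h (fun a => M a * p ^ h a)
    (fun b => p * lo b) (fun b => p * hi b) (fun a => by rw [hA]; ring)
    (fun b => by simpa only [mul_assoc] using hB b)
  have key := exists_fair_assignment (fun y => (f y, T y)) g (fun c => c.2) p
    (fun c => if #c.2 = h c.1 then M c.1 else 0) lo hi ?_ hTB Finset.univ
  · obtain ⟨φ, hφ, hφM, hφB⟩ := key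
    simp only [Finset.mem_univ, and_true] at hφ hφM
    refine ⟨fun y => Finset.univ.filter (fun v => v.2 ∈ φ y v.1), fun y => ⟨?_, ?_⟩,
      fun a S hS hinj => ?_, fun b v => ?_⟩
    · rw [Finset.card_filter, Fintype.sum_prod_type, ← hT y]
      simp [hφ]
    · rintro ⟨i, t⟩ h1 ⟨j, t'⟩ h2 (rfl : i = j)
      have h3 : #(φ y i) ≤ 1 := by
        rw [hφ]
        split_ifs <;> simp
      simp only [Finset.coe_filter, Finset.mem_univ, true_and, Set.mem_ofPred_eq] at h1 h2
      rw [Finset.card_le_one.1 h3 _ h1 _ h2]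
    · have h1 := hφM (a, S.image Prod.fst)
        (fun i => Finset.univ.filter (fun t => (i, t) ∈ S)) ?_
      · simp only [Finset.card_image_of_injOn hinj, hS, if_true,
          Finset.sdiff_eq_empty_iff_subset.2 (Finset.subset_univ _),
          Finset.card_empty, pow_zero, mul_one] at h1
        rw [← h1]
        congr 1
        ext y
        simp only [Finset.mem_filter, Finset.mem_univ, true_and, Prod.mk.injEq]
        constructor
        · rintro ⟨rfl, rfl⟩
          refine ⟨⟨rfl, ?_⟩, by ext; simp⟩
          ext i
          have h2 := hφ y i
          have h3 : (φ y i).Nonempty ↔ i ∈ T y := by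
            rw [← Finset.card_pos, h2]
            split_ifs with h4 <;> simp [h4]
          rw [← h3]
          simp [Finset.Nonempty]
        · rintro ⟨⟨rfl, h2⟩, h3⟩
          refine ⟨rfl, ?_⟩
          ext ⟨i, t⟩
          simp [h3]
      · intro i
        split_ifs with hi
        · obtain ⟨⟨i, t⟩, hv, rfl⟩ := Finset.mem_image.1 hi
          rw [Finset.card_eq_one]
          refine ⟨t, ?_⟩
          ext t'
          simp only [Finset.mem_filter, Finset.mem_univ, true_and, Finset.mem_singleton]
          constructor
          · intro hv'
            exact congrArg Prod.snd (hinj hv' hv rfl)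
          · rintro rfl
            exact hv
        · rw [Finset.card_eq_zero, Finset.filter_eq_empty_iff]
          intro t _ ht
          exact hi (Finset.mem_image_of_mem Prod.fst ht)
    · simpa using hφB b v.1 (Finset.mem_univ _) v.2
  · rintro ⟨a, S⟩
    simp only [Prod.mk.injEq]
    split_ifs with hS
    · rw [hTM a S hS, hS]
    · rw [zero_mul, Finset.card_eq_zero, Finset.filter_eq_empty_iff]
      rintro y - ⟨rfl, rfl⟩
      exact hS (hT y)

/-! ### Counting transversals, and bijections from equal fibres -/

/-- The number of partial transversals with `h` elements of a partition into `n` parts of size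
`p`. -/
theorem card_filter_injOn_part {V : Type*} [Fintype V] [DecidableEq V] {n p : ℕ} (part : V → Fin n)
    (hpart : ∀ a, #{v | part v = a} = p) (h : ℕ) [DecidablePred fun U : Finset V =>
      #U = h ∧ Set.InjOn part (U : Set V)] :
    #{U : Finset V | #U = h ∧ Set.InjOn part (U : Set V)} = n.choose h * p ^ h := by
  classical
  have hmaps : ∀ U ∈ Finset.univ.filter (fun U : Finset V => #U = h ∧ Set.InjOn part (U : Set V)),
      U.image part ∈ Finset.powersetCard h (Finset.univ : Finset (Fin n)) := by
    intro U hU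
    simp only [Finset.mem_filter, Finset.mem_univ, true_and] at hU
    simp [Finset.mem_powersetCard, Finset.card_image_of_injOn hU.2, hU.1]
  rw [Finset.card_eq_sum_card_fiberwise hmaps, Finset.sum_const_nat (m := p ^ h)]
  · simp
  intro S hS
  have hSc : #S = h := (Finset.mem_powersetCard.1 hS).2
  have hpi : #(S.pi fun a => Finset.univ.filter (fun v => part v = a)) = p ^ h := by
    rw [Finset.card_pi, Finset.prod_congr rfl fun a _ => hpart a, Finset.prod_const, hSc]
  rw [← hpi]
  symm
  -- Transversals meeting exactly the parts in `S` are the ranges of choice functions on `S`.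
  refine Finset.card_bij (fun c _ => S.attach.image fun a => c a.1 a.2) ?_ ?_ ?_
  · intro c hc
    simp only [Finset.mem_pi, Finset.mem_filter, Finset.mem_univ, true_and] at hc
    have himg : (S.attach.image fun a => c a.1 a.2).image part = S := by
      ext a
      simp only [Finset.mem_image, Finset.mem_attach, true_and, Subtype.exists]
      constructor
      · rintro ⟨v, ⟨b, hb, rfl⟩, rfl⟩
        rwa [hc]
      · intro ha
        exact ⟨_, ⟨a, ha, rfl⟩, hc a ha⟩
    have hinj : Set.InjOn part (S.attach.image fun a => c a.1 a.2 : Finset V) := by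
      intro v hv w hw hvw
      simp only [Finset.coe_image, Set.mem_image, Finset.mem_coe, Finset.mem_attach, true_and,
        Subtype.exists] at hv hw
      obtain ⟨a, ha, rfl⟩ := hv
      obtain ⟨b, hb, rfl⟩ := hw
      rw [hc, hc] at hvw
      subst hvw
      rfl
    simp only [Finset.mem_filter, Finset.mem_univ, true_and]
    refine ⟨⟨?_, hinj⟩, himg⟩
    rw [← Finset.card_image_of_injOn hinj, himg, hSc]
  · intro c hc d hd hcd
    simp only [Finset.mem_pi, Finset.mem_filter, Finset.mem_univ, true_and] at hc hd
    funext a ha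
    have : c a ha ∈ S.attach.image fun a => d a.1 a.2 := by
      rw [← hcd]
      exact Finset.mem_image.2 ⟨⟨a, ha⟩, Finset.mem_attach _ _, rfl⟩
    obtain ⟨⟨b, hb⟩, -, hba⟩ := Finset.mem_image.1 this
    have h1 := hc a ha
    rw [← hba, hd] at h1
    subst h1
    exact hba.symm
  · intro U hU
    simp only [Finset.mem_filter, Finset.mem_univ, true_and] at hU
    obtain ⟨⟨-, hinj⟩, rfl⟩ := hU
    have hex : ∀ a ∈ U.image part, ∃ v ∈ U, part v = a := fun a ha => Finset.mem_image.1 ha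
    choose c hcU hca using hex
    refine ⟨c, by simp [Finset.mem_pi, hca], ?_⟩
    ext v
    simp only [Finset.mem_image, Finset.mem_attach, true_and, Subtype.exists]
    constructor
    · rintro ⟨a, ha, rfl⟩
      exact hcU _ _
    · intro hv
      have hm := Finset.mem_image_of_mem part hv
      exact ⟨part v, Finset.mem_image.1 hm, hinj (hcU _ _) hv (hca _ _)⟩

/-- Two maps into the same type with fibres of the same sizes differ by a bijection. -/
theorem exists_equiv_of_card_fiber_eq {X Y Z : Type*} [Fintype X] [Fintype Y] [DecidableEq Z]
    (f : X → Z) (g : Y → Z) (h : ∀ z, #{x | f x = z} = #{y | g y = z}) :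
    ∃ e : X ≃ Y, ∀ x, g (e x) = f x := by
  have hne : ∀ z, Nonempty ({x // f x = z} ≃ {y // g y = z}) := by
    intro z
    rw [← Fintype.card_eq, Fintype.card_subtype, Fintype.card_subtype]
    exact h z
  refine ⟨(Equiv.sigmaFiberEquiv f).symm.trans ((Equiv.sigmaCongrRight fun z => (hne z).some).trans
    (Equiv.sigmaFiberEquiv g)), fun x => ?_⟩
  exact ((hne (f x)).some ⟨x, rfl⟩).2

/-- A partition into `n` parts of size `p` is isomorphic to `Fin n × Fin p`. -/
theorem exists_equiv_prod_of_card_part {V : Type*} [Fintype V] {n p : ℕ}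
    (part : V → Fin n) (hpart : ∀ a, #{v | part v = a} = p) :
    ∃ e : Fin n × Fin p ≃ V, ∀ x, part (e x) = x.1 := by
  refine exists_equiv_of_card_fiber_eq Prod.fst part fun a => ?_
  have h : (Finset.univ.filter fun x : Fin n × Fin p => x.1 = a) = {a} ×ˢ Finset.univ := by
    ext x
    simp [Prod.ext_iff, eq_comm]
  rw [hpart, h]
  simp

/-! ### Degrees as numbers of edges -/

namespace HingeHypergraph

variable {V E W : Type*}

theorem eq_of_mem_edgesJoining (G : HingeHypergraph V E W) {e : E} {U U' : Multiset V}
    (h : e ∈ G.edgesJoining U) (h' : e ∈ G.edgesJoining U') : U = U' := by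
  classical
  ext v
  have h1 := h v
  have h2 := h' v
  rw [h1] at h2
  convert h2

/-- If no edge meets a vertex repeatedly, then degrees are numbers of edges. -/
theorem degree_spanningSub (G : HingeHypergraph V E W) [Finite W] (U : E → Finset V)
    (hU : ∀ e, e ∈ G.edgesJoining (U e).val) (F : Set E) (v : V) :
    (G.spanningSub F).degree v = {e | e ∈ F ∧ v ∈ U e}.ncard := by
  classical
  have hcount : ∀ e, {x : W | G.vert x = v ∧ G.edge x = e}.ncard = if v ∈ U e then 1 else 0 := by
    intro e
    have h := hU e v
    rw [h]
    convert Multiset.count_eq_of_nodup (U e).nodup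
    exact Finset.mem_def
  have himg : {e | e ∈ F ∧ v ∈ U e} = (fun x : {x : W // G.edge x ∈ F} => G.edge x) ''
      {x | (G.spanningSub F).vert x = v} := by
    ext e
    constructor
    · rintro ⟨heF, hv⟩
      have h1 := hcount e
      rw [if_pos hv] at h1
      obtain ⟨x, hx⟩ := Set.nonempty_of_ncard_ne_zero (h1.trans_ne one_ne_zero)
      exact ⟨⟨x, hx.2 ▸ heF⟩, hx.1, hx.2⟩
    · rintro ⟨x, hx, rfl⟩
      refine ⟨x.2, ?_⟩
      by_contra hv
      have h1 := hcount (G.edge x)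
      -- `ncard` also vanishes on infinite sets, so finiteness of `W` matters here.
      rw [if_neg hv, Set.ncard_eq_zero (Set.toFinite _)] at h1
      exact Set.eq_empty_iff_forall_notMem.1 h1 x.1 ⟨hx, rfl⟩
  rw [himg, Set.InjOn.ncard_image]
  · rfl
  · intro x hx y hy hxy
    have h1 : {z : W | G.vert z = v ∧ G.edge z = G.edge x}.ncard ≤ 1 := by
      rw [hcount]
      split_ifs <;> simp
    exact Subtype.ext ((Set.ncard_le_one (Set.toFinite _)).1 h1 _ ⟨hx, rfl⟩ _ ⟨hy, hxy.symm⟩)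

end HingeHypergraph

/-! ### Edge colourings and matrices of edge numbers -/

/-- Both sides count the incidences of vertices with transversals of size `h`; this converts edge
numbers into degrees. -/
theorem choose_mul_pow_mul_self {n h : ℕ} (p : ℕ) (hn : 1 ≤ n) (hh : 1 ≤ h) :
    n.choose h * p ^ h * h = n * p * ((n - 1).choose (h - 1) * p ^ (h - 1)) := by
  obtain ⟨n, rfl⟩ := Nat.exists_eq_add_of_le' hn
  obtain ⟨h, rfl⟩ := Nat.exists_eq_add_of_le' hh
  have := Nat.add_one_mul_choose_eq n h
  simp only [Nat.add_sub_cancel]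
  rw [pow_succ]
  linear_combination (p ^ h * p) * this.symm

/-- The degree condition is implied by the existence of a matrix of edge numbers. -/
theorem sum_le_of_mulVec_bounds {n m k p : ℕ} (hn : 1 ≤ n) (hp : 1 ≤ p) (H Λ : Fin m → ℕ)
    (hH : ∀ j, 1 ≤ H j) (Q R : Fin k → ℕ) (A : Matrix (Fin k) (Fin m) ℕ)
    (hQ : (n * p) • Q ≤ A.mulVec H) (hR : A.mulVec H ≤ (n * p) • R)
    (hA : ∀ j, ∑ i, A i j = Λ j * n.choose (H j) * p ^ H j) :
    ∑ i, Q i ≤ ∑ j, Λ j * (n - 1).choose (H j - 1) * p ^ (H j - 1) ∧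
      ∑ j, Λ j * (n - 1).choose (H j - 1) * p ^ (H j - 1) ≤ ∑ i, R i := by
  have hsum : ∑ i, A.mulVec H i =
      n * p * ∑ j, Λ j * (n - 1).choose (H j - 1) * p ^ (H j - 1) := by
    simp only [Matrix.mulVec, dotProduct]
    rw [Finset.sum_comm, Finset.mul_sum]
    refine Finset.sum_congr rfl fun j _ => ?_
    rw [← Finset.sum_mul, hA]
    have := choose_mul_pow_mul_self p hn (hH j)
    linear_combination Λ j * this
  have hpos : 0 < n * p := Nat.mul_pos hn hp
  constructor
  · refine Nat.le_of_mul_le_mul_left ?_ hpos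
    rw [← hsum, Finset.mul_sum]
    exact Finset.sum_le_sum fun i _ => hQ i
  · refine Nat.le_of_mul_le_mul_left ?_ hpos
    rw [← hsum, Finset.mul_sum]
    exact Finset.sum_le_sum fun i _ => hR i

namespace HingeHypergraph

variable {V E W : Type*}

/-- A factorization is an edge colouring with bounds on the degrees in each colour class. -/
theorem isFactorizable_iff_exists_coloring (G : HingeHypergraph V E W) [Fintype E] [Finite W]
    (U : E → Finset V) (hU : ∀ e, e ∈ G.edgesJoining (U e).val) {k : ℕ} (Q R : Fin k → ℕ)
    [DecidableEq V] :
    G.IsFactorizable Q R ↔ ∃ col : E → Fin k, ∀ i v,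
      Q i ≤ #{e | col e = i ∧ v ∈ U e} ∧ #{e | col e = i ∧ v ∈ U e} ≤ R i := by
  have hdeg : ∀ (col : E → Fin k) i v,
      (G.spanningSub {e | col e = i}).degree v = #{e | col e = i ∧ v ∈ U e} := by
    intro col i v
    rw [degree_spanningSub G U hU, ← Set.ncard_coe_finset]
    simp
  constructor
  · rintro ⟨F, hdisj, hcov, hF⟩
    have hex : ∀ e, ∃ i, e ∈ F i := fun e => Set.mem_iUnion.1 (hcov ▸ Set.mem_univ e)
    choose col hcol using hex
    refine ⟨col, fun i v => ?_⟩
    have hFi : F i = {e | col e = i} := by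
      ext e
      constructor
      · intro he
        by_contra hne
        exact Set.disjoint_left.1 (hdisj hne) (hcol e) he
      · rintro rfl
        exact hcol e
    rw [← hdeg, ← hFi]
    exact hF i v
  · rintro ⟨col, hcol⟩
    refine ⟨fun i => {e | col e = i}, ?_, ?_, fun i v => ?_⟩
    · intro i j hij
      exact Set.disjoint_left.2 fun e hi hj => hij (hi.symm.trans hj)
    · exact Set.iUnion_eq_univ_iff.2 fun e => ⟨col e, rfl⟩
    · rw [hdeg]
      exact hcol i v

/-- In a complete multipartite hypergraph, the number of edges on a transversal, expressed through
the vertex sets `U e` of the edges. -/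
theorem IsCompleteMultipartite.card_fiber {G : HingeHypergraph V E W} [Fintype E] [DecidableEq V]
    {n m p : ℕ} {part : V → Fin n} {H Λ : Fin m → ℕ} (hG : G.IsCompleteMultipartite part p H Λ)
    (U : E → Finset V) (hU : ∀ e, e ∈ G.edgesJoining (U e).val) {j : Fin m} {S : Finset V}
    (hS : #S = H j) (hinj : Set.InjOn part S) : #{e | U e = S} = Λ j := by
  rw [← hG.mult_eq j S hS hinj, mult, ← Set.ncard_coe_finset]
  congr 1
  ext e
  simp only [Finset.coe_filter, Finset.mem_univ, true_and]
  constructor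
  · rintro rfl
    exact hU e
  · intro he
    exact Finset.val_injective (G.eq_of_mem_edgesJoining (hU e) he)

/-- A colouring with degree bounds yields a matrix of edge numbers. -/
theorem exists_matrix_of_coloring [Fintype V] [Fintype E] [DecidableEq V] {n m k p : ℕ}
    (part : V → Fin n) (hpart : ∀ a, #{v | part v = a} = p) (H Λ : Fin m → ℕ)
    (hinj : Function.Injective H) (Q R : Fin k → ℕ) (U : E → Finset V) (size : E → Fin m)
    (hsize : ∀ e, #(U e) = H (size e)) (hU : ∀ e, Set.InjOn part (U e))
    (hfib : ∀ (j : Fin m) (S : Finset V), #S = H j → Set.InjOn part S → #{e | U e = S} = Λ j)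
    (col : E → Fin k) (hcol : ∀ i v, Q i ≤ #{e | col e = i ∧ v ∈ U e} ∧
      #{e | col e = i ∧ v ∈ U e} ≤ R i) :
    ∃ A : Matrix (Fin k) (Fin m) ℕ,
      (n * p) • Q ≤ A.mulVec H ∧ A.mulVec H ≤ (n * p) • R ∧
      ∀ j, ∑ i, A i j = Λ j * n.choose (H j) * p ^ H j := by
  classical
  have hV : Fintype.card V = n * p := by
    obtain ⟨e, -⟩ := exists_equiv_prod_of_card_part part hpart
    rw [← Fintype.card_congr e]
    simp
  have hvec : ∀ i, ∑ j, #{e | col e = i ∧ size e = j} * H j =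
      ∑ v, #{e | col e = i ∧ v ∈ U e} := by
    intro i
    -- Handshake count in one colour: edge sizes and vertex degrees have the same sum.
    have h1 : ∑ e with col e = i, #(U e) = ∑ v, #{e | col e = i ∧ v ∈ U e} := by
      simp only [← Finset.filter_filter, Finset.card_eq_sum_ones (U _), Finset.card_filter,
        Finset.sum_comm (s := Finset.univ (α := V))]
      simp
    rw [← h1, ← Finset.sum_fiberwise _ size]
    refine Finset.sum_congr rfl fun j _ => ?_
    rw [Finset.sum_const_nat (m := H j), Finset.filter_filter]
    intro e he
    rw [hsize, (Finset.mem_filter.1 he).2]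
  refine ⟨Matrix.of fun i j => #{e | col e = i ∧ size e = j}, fun i => ?_, fun i => ?_,
    fun j => ?_⟩
  · simp only [Matrix.mulVec, dotProduct, Matrix.of_apply, hvec, Pi.smul_apply, smul_eq_mul]
    rw [← hV, ← smul_eq_mul, ← Finset.card_univ]
    exact Finset.card_nsmul_le_sum _ _ _ fun v _ => (hcol i v).1
  · simp only [Matrix.mulVec, dotProduct, Matrix.of_apply, hvec, Pi.smul_apply, smul_eq_mul]
    rw [← hV, ← smul_eq_mul, ← Finset.card_univ]
    exact Finset.sum_le_card_nsmul _ _ _ fun v _ => (hcol i v).2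
  · have h1 : ∑ i, #{e | col e = i ∧ size e = j} = #{e | size e = j} := by
      rw [Finset.card_eq_sum_card_fiberwise (f := col) (t := Finset.univ) (by simp)]
      simp only [Finset.filter_filter, and_comm]
    simp only [Matrix.of_apply]
    rw [h1, mul_assoc, ← card_filter_injOn_part part hpart, mul_comm, ← smul_eq_mul,
      Finset.card_eq_sum_card_fiberwise (f := U)
        (t := {S : Finset V | #S = H j ∧ Set.InjOn part (S : Set V)}), ← Finset.sum_const]
    · refine Finset.sum_congr rfl fun S hS => ?_
      obtain ⟨h2, h3⟩ := (Finset.mem_filter.1 hS).2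
      rw [← hfib j S h2 h3, Finset.filter_filter]
      congr 1
      ext e
      simp only [Finset.mem_filter, Finset.mem_univ, true_and, and_iff_right_iff_imp]
      rintro rfl
      -- Sizes are distinct, so the vertex set determines the size index.
      exact hinj ((hsize e).symm.trans h2)
    · intro e he
      have : size e = j := by simpa using he
      simp only [Finset.coe_filter, Finset.mem_univ, true_and]
      exact ⟨this ▸ hsize e, hU e⟩

/-- A matrix of edge numbers yields a colouring with degree bounds. -/
theorem exists_coloring_of_matrix [Fintype V] [Fintype E] [DecidableEq V] {n m k p : ℕ}
    (part : V → Fin n) (hpart : ∀ a, #{v | part v = a} = p) (H Λ : Fin m → ℕ)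
    (hinj : Function.Injective H) (Q R : Fin k → ℕ) (U : E → Finset V) (size : E → Fin m)
    (hsize : ∀ e, #(U e) = H (size e)) (hU : ∀ e, Set.InjOn part (U e))
    (hfib : ∀ (j : Fin m) (S : Finset V), #S = H j → Set.InjOn part S → #{e | U e = S} = Λ j)
    (A : Matrix (Fin k) (Fin m) ℕ) (hQ : (n * p) • Q ≤ A.mulVec H)
    (hR : A.mulVec H ≤ (n * p) • R) (hA : ∀ j, ∑ i, A i j = Λ j * n.choose (H j) * p ^ H j) :
    ∃ col : E → Fin k, ∀ i v, Q i ≤ #{e | col e = i ∧ v ∈ U e} ∧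
      #{e | col e = i ∧ v ∈ U e} ≤ R i := by
  classical
  obtain ⟨ev, hev⟩ := exists_equiv_prod_of_card_part part hpart
  have hvec : ∀ i, ∑ x : (Σ q : Fin k × Fin m, Fin (A q.1 q.2)) with x.1.1 = i, H x.1.2 =
      A.mulVec H i := by
    intro i
    rw [Finset.sum_filter, Fintype.sum_sigma, Fintype.sum_prod_type]
    simp [Matrix.mulVec, dotProduct]
  -- The sigma type supplies `A i j` abstract edges of colour `i` and size `H j`.
  obtain ⟨T, hT, hTM, hTB⟩ := exists_fair_transversals
    (X := Σ q : Fin k × Fin m, Fin (A q.1 q.2)) (fun x => x.1.2) (fun x => x.1.1) n p H Λ Q R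
    (fun j => by
      rw [← hA, Finset.card_filter, Fintype.sum_sigma, Fintype.sum_prod_type]
      simp [apply_ite Finset.card])
    (fun i => by
      rw [hvec]
      exact ⟨hQ i, hR i⟩)
  have hinjT : ∀ S : Finset (Fin n × Fin p), Set.InjOn Prod.fst (S : Set (Fin n × Fin p)) ↔
      Set.InjOn part (S.map ev.toEmbedding : Finset V) := by
    intro S
    rw [Finset.coe_map, Equiv.coe_toEmbedding, ← ev.injective.injOn.comp_iff]
    simp only [Function.comp_def, hev]
  -- Over a transversal of size `H j` both fibres have `Λ j` elements, and over any other set both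
  -- are empty.
  obtain ⟨φ, hφ⟩ := exists_equiv_of_card_fiber_eq (fun x => (T x).map ev.toEmbedding) U (by
    intro S
    obtain ⟨S, rfl⟩ : ∃ S' : Finset (Fin n × Fin p), S'.map ev.toEmbedding = S :=
      ⟨S.map ev.symm.toEmbedding, by ext; simp⟩
    simp only [Finset.map_inj]
    by_cases hS : ∃ j, #S = H j ∧ Set.InjOn Prod.fst (S : Set (Fin n × Fin p))
    · obtain ⟨j, hj, hSi⟩ := hS
      rw [hfib j _ (by simpa using hj) ((hinjT S).1 hSi), ← hTM j S hj hSi]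
      congr 1
      ext x
      simp only [Finset.mem_filter, Finset.mem_univ, true_and, iff_and_self]
      rintro rfl
      exact hinj ((hT x).1.symm.trans hj)
    · rw [Finset.filter_false_of_mem, Finset.filter_false_of_mem (s := Finset.univ (α := E)),
        Finset.card_empty, Finset.card_empty]
      · intro e _ he
        exact hS ⟨size e, by rw [← hsize, he, Finset.card_map], (hinjT S).2 (he ▸ hU e)⟩
      · rintro x - h
        subst h
        exact hS ⟨x.1.2, (hT x).1, (hT x).2⟩)
  refine ⟨fun e => (φ.symm e).1.1, fun i v => ?_⟩
  have hcard : #{e | (φ.symm e).1.1 = i ∧ v ∈ U e} = #{x | x.1.1 = i ∧ ev.symm v ∈ T x} := by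
    refine Finset.card_equiv φ.symm fun e => ?_
    have := hφ (φ.symm e)
    rw [Equiv.apply_symm_apply] at this
    simp [this]
  rw [hcard]
  exact hTB i (ev.symm v)

end HingeHypergraph

end

theorem theorem6p5 {V E W : Type*} [Finite V] [Finite E] [Finite W]
    {n m k p : ℕ} (hn : 1 ≤ n) (hp : 1 ≤ p)
    (H Λ : Fin m → ℕ) (hH : ∀ j, 2 ≤ H j ∧ H j ≤ n) (hinj : Function.Injective H)
    (Q R : Fin k → ℕ)
    (G : HingeHypergraph V E W) (part : V → Fin n) (hG : G.IsCompleteMultipartite part p H Λ) :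
    G.IsFactorizable Q R ↔
      (∑ i, Q i ≤ ∑ j, Λ j * (n - 1).choose (H j - 1) * p ^ (H j - 1) ∧
        ∑ j, Λ j * (n - 1).choose (H j - 1) * p ^ (H j - 1) ≤ ∑ i, R i) ∧
      ∃ A : Matrix (Fin k) (Fin m) ℕ,
        (n * p) • Q ≤ A.mulVec H ∧ A.mulVec H ≤ (n * p) • R ∧
        ∀ j, ∑ i, A i j = Λ j * n.choose (H j) * p ^ H j := by
  classical
  cases nonempty_fintype V
  cases nonempty_fintype E
  have hpart : ∀ a, (Finset.univ.filter fun v => part v = a).card = p := by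
    intro a
    rw [← hG.ncard_part a, ← Set.ncard_coe_finset]
    simp
  choose size U hsize hU hmem using hG.exists_mem
  rw [G.isFactorizable_iff_exists_coloring U hmem]
  constructor
  · rintro ⟨col, hcol⟩
    obtain ⟨A, hQ, hR, hA⟩ := HingeHypergraph.exists_matrix_of_coloring part hpart H Λ hinj Q R U
      size hsize hU (fun _ _ => hG.card_fiber U hmem) col hcol
    exact ⟨sum_le_of_mulVec_bounds hn hp H Λ (fun j => one_le_two.trans (hH j).1) Q R A hQ hR hA,
      A, hQ, hR, hA⟩
  · rintro ⟨-, A, hQ, hR, hA⟩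
    exact HingeHypergraph.exists_coloring_of_matrix part hpart H Λ hinj Q R U size hsize hU
      (fun _ _ => hG.card_fiber U hmem) A hQ hR hA
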